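/- For positive integers $N$ and $k$, let $s(N,k)$ denote the (unsigned) Stirling number of the first kind, that is, the number of permutations of $N$ elements with exactly $k$ disjoint cycles, and let $v_3$ denote the $3$-adic valuation on the integers, with $v_3(0)=\infty$. Let $n$ and $k$ be positive integers with $k\le 2\cdot 3^n$. If $n\ge 2$, then $$v_3\big(s(2\cdot 3^n,k)\big)\le v_3\big(s(2\cdot 3^n,1)\big)=3^n-n-1.$$ If $n=1$, then $$v_3\big(s(6,k)\big)\le v_3\big(s(6,3)\big)=2.$$ -/

import Mathlib

/-! Write N = 2·3^n and n = j+1+d. Grouping the factors of the rising factorial in threes gives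
translates of X(X+1)(X+2) ≡ X³-X mod 3, and repeated cubing lifts this to a congruence mod 3^(j+1)
when d = 0. Each substitution X ↦ 3X splits off a power of 3 and a factor close to 1. Hence
s(N,k)·3^(dk) = 3^E·G_k with E = 3^n - 3^(j+1) and G ≡ (X³-X)^(2·3^j) mod 3^(j+1)
(`exists_risingPoly_comp_three_pow_mul`).

For even k between 2·3^j and 2·3^(j+1), G_k is ± a binomial coefficient of 2·3^j, which 3^(j+1) does
not divide; this bounds v₃(s(N,k)). For odd k these coefficients of X³-X vanish. Instead the
reflection x ↦ -x ties s(N,k) to N·k·s(N,k+1) up to higher terms (`two_mul_stirlingFirst_odd`), so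
too much divisibility at k would contradict the bound at k+1. At k = 1 the value is (N-1)!. -/

/-! ### Rising factorials as products of translates -/

open Polynomial in
/-- The rising factorial `X (X + 1) ⋯ (X + N - 1)`. -/
noncomputable def risingPoly (N : ℕ) : ℤ[X] := ∏ i ∈ Finset.range N, (X + C (i : ℤ))

open Polynomial in
/-- The product of the translates `P(X + 3 i)`, `i < M`. -/
noncomputable def translateProd (P : ℤ[X]) (M : ℕ) : ℤ[X] :=
  ∏ i ∈ Finset.range M, P.comp (X + C (3 * i : ℤ))

open Polynomial in
theorem coeff_risingPoly (N k : ℕ) : (risingPoly N).coeff k = Nat.stirlingFirst N k := by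
  induction N generalizing k with
  | zero => cases k <;> simp [risingPoly, coeff_one]
  | succ N ih =>
    have h : risingPoly (N + 1) = risingPoly N * X + risingPoly N * C (N : ℤ) := by
      rw [risingPoly, Finset.prod_range_succ, ← risingPoly, mul_add]
    cases k with
    | zero => cases N <;> simp [h, ih]
    | succ k =>
      rw [h, coeff_add, coeff_mul_X, coeff_mul_C, ih, ih, Nat.stirlingFirst_succ_succ]
      push_cast; ring

open Polynomial in
theorem risingPoly_three_mul (M : ℕ) :
    risingPoly (3 * M) = translateProd (X * (X + 1) * (X + 2)) M := by
  induction M with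
  | zero => simp [risingPoly, translateProd]
  | succ M ih =>
    rw [translateProd, Finset.prod_range_succ, ← translateProd, ← ih, risingPoly,
      show 3 * (M + 1) = 3 * M + 1 + 1 + 1 by ring, Finset.prod_range_succ,
      Finset.prod_range_succ, Finset.prod_range_succ, ← risingPoly]
    simp
    ring

open Polynomial in
theorem translateProd_add (P : ℤ[X]) (M L : ℕ) :
    translateProd P (M + L) =
      translateProd P M * (translateProd P L).comp (X + C (3 * M : ℤ)) := by
  rw [translateProd, Finset.prod_range_add, translateProd, translateProd, prod_comp]
  congr 1
  refine Finset.prod_congr rfl fun i _ => ?_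
  rw [comp_assoc]
  congr 1
  simp
  ring

/-! ### Congruences modulo powers of 3 -/

open Polynomial in
theorem exists_comp_X_add_C (P : ℤ[X]) (c : ℤ) :
    ∃ R : ℤ[X], P.comp (X + C c) = P + C c * derivative P + C c ^ 2 * R := by
  induction P using Polynomial.induction_on' with
  | add p q hp hq =>
    obtain ⟨r, hr⟩ := hp
    obtain ⟨s, hs⟩ := hq
    exact ⟨r + s, by rw [add_comp, hr, hs, derivative_add]; ring⟩
  | monomial n a =>
    induction n with
    | zero => exact ⟨0, by simp⟩
    | succ n ih =>
      obtain ⟨r, hr⟩ := ih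
      refine ⟨derivative (monomial n a) + r * (X + C c), ?_⟩
      rw [← monomial_mul_X, mul_comp, hr, X_comp, derivative_mul, derivative_X]
      ring

-- The first-order terms c·P' and 2c·P' add up to 3c·P', and the remaining terms carry c², a
-- multiple of 3c.
open Polynomial in
theorem cube_sub_translates_dvd (P : ℤ[X]) (c : ℤ) (hc : 3 ∣ c) :
    (C (3 * c) : ℤ[X]) ∣ P * P.comp (X + C c) * P.comp (X + C (2 * c)) - P ^ 3 := by
  obtain ⟨R, hR⟩ := exists_comp_X_add_C P c
  obtain ⟨S, hS⟩ := exists_comp_X_add_C P (2 * c)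
  obtain ⟨e, rfl⟩ := hc
  rw [hR, hS]
  simp only [map_mul, map_ofNat]
  generalize C e = e
  generalize derivative P = D
  refine ⟨P ^ 2 * D + P * (e * R * (P + 6 * e * D + 36 * e ^ 2 * S)
    + (P + 3 * e * D) * 4 * e * S + 2 * e * D ^ 2), ?_⟩
  ring

theorem three_pow_dvd_cube_sub {R : Type*} [CommRing R] {a b : R} {n : ℕ}
    (h : (3 : R) ^ (n + 1) ∣ a - b) : (3 : R) ^ (n + 2) ∣ a ^ 3 - b ^ 3 := by
  obtain ⟨q, hq⟩ := h
  obtain rfl : a = b + 3 ^ (n + 1) * q := by rw [← hq]; ring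
  exact ⟨q * (b ^ 2 + 3 ^ (n + 1) * q * b + 3 ^ (2 * n + 1) * q ^ 2), by ring⟩

-- Induction on n: tripling the length multiplies three translates, which is a cube up to 3^(n+2),
-- and cubing gains one power of 3.
open Polynomial in
theorem translateProd_modEq (P Q : ℤ[X]) (h : (3 : ℤ[X]) ∣ P - Q) (n : ℕ) :
    (3 : ℤ[X]) ^ (n + 1) ∣ translateProd P (2 * 3 ^ n) - Q ^ (2 * 3 ^ n) := by
  induction n with
  | zero =>
    obtain ⟨R, hR⟩ := exists_comp_X_add_C P 3
    obtain ⟨S, hS⟩ := h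
    obtain rfl : P = Q + 3 * S := by rw [← hS]; ring
    simp [translateProd, Finset.prod_range_succ]
    simp only [add_comp, map_ofNat, mul_comp] at hR
    have e : (ofNat(3) : ℤ[X]).comp (X + 3) = 3 := ofNat_comp ..
    rw [e] at hR
    rw [hR]
    generalize derivative (Q + 3 * S) = D
    exact ⟨2 * Q * S + 3 * S ^ 2 + (Q + 3 * S) * (D + 3 * R), by ring⟩
  | succ n ih =>
    have e : translateProd P (2 * 3 ^ (n + 1)) =
        translateProd P (2 * 3 ^ n) *
          (translateProd P (2 * 3 ^ n)).comp (X + C (3 * (2 * 3 ^ n : ℕ) : ℤ)) *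
          (translateProd P (2 * 3 ^ n)).comp (X + C (2 * (3 * (2 * 3 ^ n : ℕ)) : ℤ)) := by
      rw [show 2 * 3 ^ (n + 1) = 2 * 3 ^ n + 2 * 3 ^ n + 2 * 3 ^ n by ring, translateProd_add,
        translateProd_add]
      congr 4
      push_cast
      ring
    have h1 := cube_sub_translates_dvd (translateProd P (2 * 3 ^ n))
      (3 * (2 * 3 ^ n : ℕ) : ℤ) (dvd_mul_right _ _)
    rw [← e] at h1
    have h2 := three_pow_dvd_cube_sub ih
    have h3 : (3 : ℤ[X]) ^ (n + 1 + 1) ∣ C (3 * (3 * (2 * 3 ^ n : ℕ)) : ℤ) :=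
      ⟨2, by simp; ring⟩
    rw [← pow_mul, mul_assoc, ← pow_succ] at h2
    simpa using dvd_add (h3.trans h1) h2

-- Here (X+1)(X+2) ≡ X²-1 mod 3; at 3X this becomes 9X²-1 ≡ -1, and the even exponent removes the
-- sign.
open Polynomial in
theorem translateProd_units_comp_three_mul (n : ℕ) :
    (3 : ℤ[X]) ^ (n + 1) ∣
      (translateProd ((X + 1) * (X + 2)) (2 * 3 ^ n)).comp (C 3 * X) - 1 := by
  obtain ⟨R, hR⟩ := translateProd_modEq ((X + 1) * (X + 2)) (X ^ 2 - 1) ⟨X + 1, by ring⟩ n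
  have key : (3 : ℤ[X]) ^ (n + 1) ∣ (9 * X ^ 2 - 1) ^ (2 * 3 ^ n) - 1 := by
    clear hR R
    induction n with
    | zero => exact ⟨27 * X ^ 4 - 6 * X ^ 2, by ring⟩
    | succ n ih =>
      have := three_pow_dvd_cube_sub ih
      rwa [← pow_mul, mul_assoc, ← pow_succ, one_pow] at this
  have e : (translateProd ((X + 1) * (X + 2)) (2 * 3 ^ n)).comp (C 3 * X) =
      (9 * X ^ 2 - 1) ^ (2 * 3 ^ n) + 3 ^ (n + 1) * R.comp (C 3 * X) := by
    rw [sub_eq_iff_eq_add.1 hR]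
    have : (ofNat(3) : ℤ[X]).comp (C 3 * X) = 3 := ofNat_comp ..
    simp only [add_comp, mul_comp, pow_comp, sub_comp, X_comp, one_comp, this]
    simp
    ring
  rw [e, add_sub_right_comm]
  exact dvd_add key (dvd_mul_right _ _)

/-! ### Rescaling by powers of 3, and the even indices -/

open Polynomial in
theorem risingPoly_comp_three_mul (M : ℕ) :
    (risingPoly (3 * M)).comp (C 3 * X) =
      3 ^ M * risingPoly M * (translateProd ((X + 1) * (X + 2)) M).comp (C 3 * X) := by
  have h : (3 : ℤ[X]) ^ M = ∏ _i ∈ Finset.range M, 3 := by simp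
  rw [risingPoly_three_mul, translateProd, translateProd, risingPoly, prod_comp, prod_comp, h,
    ← Finset.prod_mul_distrib, ← Finset.prod_mul_distrib]
  refine Finset.prod_congr rfl fun i _ => ?_
  simp
  ring

open Polynomial in
theorem risingPoly_modEq (j : ℕ) :
    (3 : ℤ[X]) ^ (j + 1) ∣ risingPoly (2 * 3 ^ (j + 1)) - (X ^ 3 - X) ^ (2 * 3 ^ j) := by
  rw [show 2 * 3 ^ (j + 1) = 3 * (2 * 3 ^ j) by ring, risingPoly_three_mul]
  exact translateProd_modEq _ _ ⟨X ^ 2 + X, by ring⟩ j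

open Polynomial in
/-- After rescaling by `3 ^ d` and removing the content, the rising factorial is congruent
to a power of `X ^ 3 - X`. -/
theorem exists_risingPoly_comp_three_pow_mul (j d : ℕ) :
    ∃ G : ℤ[X], (risingPoly (2 * 3 ^ (j + 1 + d))).comp (C (3 ^ d) * X) =
        C (3 ^ (3 ^ (j + 1 + d) - 3 ^ (j + 1))) * G ∧
      (3 : ℤ[X]) ^ (j + 1) ∣ G - (X ^ 3 - X) ^ (2 * 3 ^ j) := by
  induction d with
  | zero => exact ⟨_, by simp, risingPoly_modEq j⟩
  | succ d ih =>
    obtain ⟨G, hG, hd⟩ := ih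
    obtain ⟨R, hR⟩ := translateProd_units_comp_three_mul (j + 1 + d)
    have e : (translateProd ((X + 1) * (X + 2)) (2 * 3 ^ (j + 1 + d))).comp
        (C 3 * (C (3 ^ d) * X)) = 1 + 3 ^ (j + 1 + d + 1) * R.comp (C (3 ^ d) * X) := by
      have := congrArg (fun p => p.comp (C (3 ^ d) * X)) (sub_eq_iff_eq_add.1 hR)
      have h3 : (ofNat(3) : ℤ[X]).comp (C (3 ^ d) * X) = 3 := ofNat_comp ..
      simp only [comp_assoc, mul_comp, X_comp, C_comp, add_comp, one_comp, pow_comp, h3] at this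
      rw [this]; ring
    refine ⟨G * (1 + 3 ^ (j + 1 + d + 1) * R.comp (C (3 ^ d) * X)), ?_, ?_⟩
    · have h := congrArg (fun p => p.comp (C (3 ^ d) * X))
        (risingPoly_comp_three_mul (2 * 3 ^ (j + 1 + d)))
      have h3 : (ofNat(3) : ℤ[X]).comp (C (3 ^ d) * X) = 3 := ofNat_comp ..
      simp only [comp_assoc, mul_comp, X_comp, C_comp, pow_comp, h3] at h
      rw [e, hG] at h
      have hE : 3 ^ (j + 1 + (d + 1)) - 3 ^ (j + 1) =
          2 * 3 ^ (j + 1 + d) + (3 ^ (j + 1 + d) - 3 ^ (j + 1)) := by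
        have := Nat.pow_le_pow_right (n := 3) (by norm_num) (Nat.le_add_right (j + 1) d)
        have : 3 ^ (j + 1 + (d + 1)) = 3 * 3 ^ (j + 1 + d) := by ring
        omega
      rw [show 2 * 3 ^ (j + 1 + (d + 1)) = 3 * (2 * 3 ^ (j + 1 + d)) by ring,
        show (C (3 ^ (d + 1)) * X : ℤ[X]) = C 3 * (C (3 ^ d) * X) by simp; ring, h, hE]
      simp only [pow_add (3 : ℤ) (2 * _), map_mul, map_pow, map_ofNat]
      ring
    · have : G * (1 + 3 ^ (j + 1 + d + 1) * R.comp (C (3 ^ d) * X)) - (X ^ 3 - X) ^ (2 * 3 ^ j) =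
          (G - (X ^ 3 - X) ^ (2 * 3 ^ j)) +
            3 ^ (j + 1) * (3 ^ (d + 1) * G * R.comp (C (3 ^ d) * X)) := by ring
      rw [this]
      exact dvd_add hd (dvd_mul_right _ _)

theorem three_pow_dvd_stirlingFirst_mul (j d k : ℕ) :
    (3 : ℤ) ^ (3 ^ (j + 1 + d) - 3 ^ (j + 1)) ∣
      Nat.stirlingFirst (2 * 3 ^ (j + 1 + d)) k * 3 ^ (d * k) := by
  obtain ⟨G, hG, -⟩ := exists_risingPoly_comp_three_pow_mul j d
  have := congrArg (fun p => p.coeff k) hG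
  simp only [Polynomial.comp_C_mul_X_coeff, Polynomial.coeff_C_mul, coeff_risingPoly,
    ← pow_mul] at this
  exact ⟨_, this⟩

open Polynomial in
theorem coeff_X_pow_three_sub_X_pow (M t : ℕ) :
    ((X ^ 3 - X : ℤ[X]) ^ M).coeff (M + 2 * t) = (-1) ^ (M - t) * M.choose t := by
  -- X³-X = X·(X²-1), so only exponents of the form M+2t occur.
  have : (X ^ 3 - X : ℤ[X]) ^ M = expand ℤ 2 ((X + C (-1)) ^ M) * X ^ M := by
    rw [map_pow, ← mul_pow]
    congr 1
    simp
    ring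
  rw [this, add_comm M, coeff_mul_X_pow, mul_comm 2, coeff_expand_mul (by norm_num),
    coeff_X_add_C_pow]

/-- By Kummer, the 3-adic valuation is at most log₃(2·3^j), whose floor is j. -/
theorem not_three_pow_dvd_choose (j t : ℕ) (ht : t ≤ 2 * 3 ^ j) :
    ¬ 3 ^ (j + 1) ∣ (2 * 3 ^ j).choose t := by
  have hlog : Nat.log 3 (2 * 3 ^ j) ≤ j := by
    rw [Nat.lt_succ_iff.symm]
    refine Nat.log_lt_of_lt_pow (by positivity) ?_
    have : 3 ^ j.succ = 3 * 3 ^ j := by rw [pow_succ]; ring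
    have : 0 < 3 ^ j := by positivity
    omega
  have h := Nat.factorization_choose_le_log (p := 3) (n := 2 * 3 ^ j) (k := t)
  rw [Nat.prime_three.pow_dvd_iff_le_factorization (Nat.choose_pos ht).ne']
  omega

theorem not_three_pow_dvd_stirlingFirst_mul (j d t : ℕ) (ht : t ≤ 2 * 3 ^ j) :
    ¬ (3 : ℤ) ^ (3 ^ (j + 1 + d) - 3 ^ (j + 1) + (j + 1)) ∣
      Nat.stirlingFirst (2 * 3 ^ (j + 1 + d)) (2 * 3 ^ j + 2 * t) *
        3 ^ (d * (2 * 3 ^ j + 2 * t)) := by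
  obtain ⟨G, hG, R, hR⟩ := exists_risingPoly_comp_three_pow_mul j d
  have h := congrArg (fun p => p.coeff (2 * 3 ^ j + 2 * t)) hG
  have h' := congrArg (fun p => p.coeff (2 * 3 ^ j + 2 * t)) hR
  have h3 : (3 : Polynomial ℤ) ^ (j + 1) = Polynomial.C (3 ^ (j + 1)) := by simp
  simp only [Polynomial.comp_C_mul_X_coeff, Polynomial.coeff_C_mul, coeff_risingPoly, h3,
    ← pow_mul, Polynomial.coeff_sub, coeff_X_pow_three_sub_X_pow] at h h'
  rw [h, pow_add, mul_dvd_mul_iff_left (by positivity), sub_eq_iff_eq_add.1 h',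
    dvd_add_right (dvd_mul_right _ _), IsUnit.dvd_mul_left (isUnit_one.neg.pow _)]
  exact_mod_cast not_three_pow_dvd_choose j t ht

/-! ### Reflection symmetry and the odd indices -/

open Polynomial in
theorem coeff_comp_neg_X (p : ℤ[X]) (k : ℕ) : (p.comp (-X)).coeff k = (-1) ^ k * p.coeff k := by
  have : (-X : ℤ[X]) = C (-1) * X := by simp
  rw [this, comp_C_mul_X_coeff, mul_comm]

open Polynomial in
theorem coeff_taylor_eq_sum (p : ℤ[X]) (c : ℤ) (i L : ℕ) (hL : p.natDegree < L) :
    (taylor c p).coeff i =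
      ∑ r ∈ Finset.range L, ((i + r).choose i : ℤ) * p.coeff (i + r) * c ^ r := by
  have h := (natDegree_hasseDeriv_le p i).trans_lt ((Nat.sub_le _ _).trans_lt hL)
  rw [taylor_coeff, eval_eq_sum_range' h]
  refine Finset.sum_congr rfl fun r _ => ?_
  rw [hasseDeriv_coeff, add_comm r i]

-- The roots -1, …, -L are symmetric under x ↦ -(L+1)-x.
open Polynomial in
theorem prod_X_add_succ_comp_neg (L : ℕ) :
    (∏ i ∈ Finset.range L, (X + C ((i : ℤ) + 1))).comp (-X) =
      (-1) ^ L * taylor (-(L + 1 : ℤ)) (∏ i ∈ Finset.range L, (X + C ((i : ℤ) + 1))) := by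
  have hneg : (-1 : ℤ[X]) ^ L = ∏ _i ∈ Finset.range L, (-1) := by simp
  have hrefl := Finset.prod_range_reflect
    (fun i : ℕ => (X + C ((i : ℤ) + 1)).comp (X + C (-(L + 1 : ℤ)))) L
  rw [taylor_apply, prod_comp, prod_comp, ← hrefl, hneg, ← Finset.prod_mul_distrib]
  refine Finset.prod_congr rfl fun i hi => ?_
  have : L - 1 - i + (i + 1) = L := by have := Finset.mem_range.1 hi; omega
  have h : (L : ℤ[X]) = ((L - 1 - i : ℕ) : ℤ[X]) + (i + 1) := by exact_mod_cast this.symm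
  simp [h]
  ring

open Polynomial in
theorem coeff_prod_X_add_succ (L k : ℕ) :
    (∏ i ∈ Finset.range L, (X + C ((i : ℤ) + 1))).coeff k =
      (Nat.stirlingFirst (L + 1) (k + 1) : ℤ) := by
  rw [← coeff_risingPoly, risingPoly, Finset.prod_range_succ']
  simp [coeff_mul_X]

/-- The reflection symmetry of the rising factorial of even order, on coefficients. -/
theorem two_mul_stirlingFirst_odd (L m : ℕ) (hL : Odd L) :
    2 * (Nat.stirlingFirst (L + 1) (2 * m + 1) : ℤ) =
      (L + 1) * (2 * m + 1) * Nat.stirlingFirst (L + 1) (2 * m + 2) -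
        ∑ r ∈ Finset.range L, ((2 * m + (r + 2)).choose (2 * m) : ℤ) *
          Nat.stirlingFirst (L + 1) (2 * m + 1 + (r + 2)) * (-(L + 1 : ℤ)) ^ (r + 2) := by
  set p : Polynomial ℤ := ∏ i ∈ Finset.range L, (Polynomial.X + Polynomial.C ((i : ℤ) + 1))
    with hp
  have hdeg : p.natDegree < L + 2 := by
    refine (Polynomial.natDegree_prod_le _ _).trans_lt
      ((Finset.sum_le_card_nsmul _ _ 1 fun i _ => (Polynomial.natDegree_X_add_C _).le).trans_lt ?_)
    simp
  have h := congrArg (fun q => q.coeff (2 * m)) (prod_X_add_succ_comp_neg L)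
  simp only [← hp, hL.neg_one_pow, neg_one_mul, Polynomial.coeff_neg, coeff_comp_neg_X,
    (even_two_mul m).neg_one_pow, one_mul] at h
  rw [coeff_taylor_eq_sum p _ _ _ hdeg, Finset.sum_range_succ', Finset.sum_range_succ'] at h
  simp only [hp, coeff_prod_X_add_succ, add_zero, zero_add, pow_zero, pow_one, Nat.choose_self,
    Nat.choose_succ_self_right, Nat.cast_one, mul_one, one_mul] at h
  have e : ∀ r, 2 * m + (r + 1 + 1) + 1 = 2 * m + 1 + (r + 2) := fun r => by ring
  have e' : ∀ r, r + 1 + 1 = r + 2 := fun r => rfl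
  simp only [e, e'] at h
  push_cast at h ⊢
  linear_combination h

/-- If `3 ^ v ∣ i + 1`, then `C(i + r + 2, i)` loses at most a factor `3 ^ r` of it. -/
theorem three_pow_dvd_choose_mul (i r v : ℕ) (h : 3 ^ v ∣ i + 1) :
    3 ^ v ∣ (i + (r + 2)).choose i * 3 ^ r := by
  -- The product equals C(i+r+2, i+1)·(i+1). It remains to cancel r+2, whose valuation is at most r
  -- because r+2 < 3^(r+1).
  have h1 : 3 ^ v ∣ (i + (r + 2)).choose i * (r + 2) := by
    have := Nat.choose_succ_right_eq (i + (r + 2)) i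
    rw [Nat.add_sub_cancel_left] at this
    rw [← this]
    exact h.mul_left _
  obtain ⟨w, u, hu, hw⟩ := Nat.exists_eq_pow_mul_and_not_dvd (n := r + 2) (by omega) 3
    (by norm_num)
  have hwr : w ≤ r := by
    by_contra! hlt
    have h2 : 3 ^ (r + 1) ≤ r + 2 :=
      (Nat.pow_le_pow_right (by norm_num) hlt).trans (Nat.le_of_dvd (by omega) ⟨u, hw⟩)
    have h3 : ∀ r : ℕ, r + 2 < 3 ^ (r + 1) := fun r => by
      induction r with
      | zero => norm_num
      | succ r ih => rw [pow_succ]; omega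
    exact absurd h2 (not_le.2 (h3 r))
  have h2 : 3 ^ v ∣ (i + (r + 2)).choose i * 3 ^ w * u := by rwa [mul_assoc, ← hw]
  exact (((Nat.prime_three.coprime_iff_not_dvd.2 hu).pow_left v).dvd_of_dvd_mul_right h2).trans
    (mul_dvd_mul_left _ (pow_dvd_pow 3 hwr))

/-- Divisibility of an odd-index coefficient passes to the next even-index one. -/
theorem three_pow_dvd_succ_of_odd (j d m v T : ℕ) (hv : 3 ^ v ∣ 2 * m + 1)
    (hv' : ¬ 3 ^ (v + 1) ∣ 2 * m + 1)
    (hT : j + 1 + d + v + (3 ^ (j + 1 + d) - 3 ^ (j + 1) + (j + 1)) ≤ T + d * (2 * m + 2))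
    (h : (3 : ℤ) ^ T ∣ Nat.stirlingFirst (2 * 3 ^ (j + 1 + d)) (2 * m + 1)) :
    (3 : ℤ) ^ (3 ^ (j + 1 + d) - 3 ^ (j + 1) + (j + 1)) ∣
      Nat.stirlingFirst (2 * 3 ^ (j + 1 + d)) (2 * m + 2) * 3 ^ (d * (2 * m + 2)) := by
  set E := 3 ^ (j + 1 + d) - 3 ^ (j + 1) with hE
  obtain ⟨L, hL⟩ : ∃ L, 2 * 3 ^ (j + 1 + d) = L + 1 :=
    ⟨_, (Nat.sub_add_cancel (by have : 0 < 3 ^ (j + 1 + d) := by positivity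
                                omega)).symm⟩
  have hLodd : Odd L := by
    rw [← Nat.not_even_iff_odd]
    intro hev
    have : Even (L + 1) := hL ▸ even_two_mul _
    exact absurd hev (Nat.even_add_one.1 this)
  have key := two_mul_stirlingFirst_odd L m hLodd
  rw [← hL] at key
  have hL' : (L + 1 : ℤ) = 2 * 3 ^ (j + 1 + d) := by exact_mod_cast hL.symm
  rw [hL'] at key
  obtain ⟨u, hu⟩ := hv
  have hu3 : ¬ 3 ∣ u := by
    rintro ⟨w, rfl⟩
    exact hv' ⟨w, by rw [hu]; ring⟩
  have hmain : (3 : ℤ) ^ (j + 1 + d + v + (E + (j + 1))) ∣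
      (2 * 3 ^ (j + 1 + d)) * (2 * m + 1) * (Nat.stirlingFirst (2 * 3 ^ (j + 1 + d)) (2 * m + 2) *
        3 ^ (d * (2 * m + 2))) := by
    have e : (2 * 3 ^ (j + 1 + d)) * (2 * m + 1) *
        ((Nat.stirlingFirst (2 * 3 ^ (j + 1 + d)) (2 * m + 2) : ℤ) * 3 ^ (d * (2 * m + 2))) =
        2 * (Nat.stirlingFirst (2 * 3 ^ (j + 1 + d)) (2 * m + 1) * 3 ^ (d * (2 * m + 2))) +
        ∑ r ∈ Finset.range L, ((2 * m + (r + 2)).choose (2 * m) : ℤ) *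
          Nat.stirlingFirst (2 * 3 ^ (j + 1 + d)) (2 * m + 1 + (r + 2)) *
            (-(2 * 3 ^ (j + 1 + d) : ℤ)) ^ (r + 2) * 3 ^ (d * (2 * m + 2)) := by
      rw [← Finset.sum_mul]
      linear_combination (-(3 : ℤ) ^ (d * (2 * m + 2))) * key
    rw [e]
    refine dvd_add (Dvd.dvd.mul_left ?_ _) (Finset.dvd_sum fun r _ => ?_)
    · exact (pow_dvd_pow 3 hT).trans (by rw [pow_add]; exact mul_dvd_mul_right h _)
    -- The extra factor raises the weight to d·(2m+3+r), the one matching the index of this Stirling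
    -- number, so the content 3^E applies. The factor N^(r+2) pays for it and for the loss 3^r, with
    -- j·r to spare.
    · rw [← mul_dvd_mul_iff_right (pow_ne_zero (d * (r + 1)) (three_ne_zero (α := ℤ)))]
      have h1 := three_pow_dvd_stirlingFirst_mul j d (2 * m + 1 + (r + 2))
      rw [← hE] at h1
      have h2 : (3 : ℤ) ^ v ∣ ((2 * m + (r + 2)).choose (2 * m) : ℤ) * 3 ^ r := by
        exact_mod_cast three_pow_dvd_choose_mul (2 * m) r v ⟨u, hu⟩
      have h3 : (3 : ℤ) ^ (j + 1 + d + (j + 1) + d * (r + 1)) ∣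
          3 ^ (j + 1 + d + (j + 1) + d * (r + 1) + j * r) :=
        pow_dvd_pow 3 (Nat.le_add_right _ _)
      have h4 := (mul_dvd_mul (mul_dvd_mul h1 h2) h3).mul_left ((-2) ^ (r + 2))
      refine (dvd_of_eq ?_).trans (h4.trans (dvd_of_eq ?_))
      · ring
      · rw [neg_mul_eq_neg_mul, mul_pow]
        ring
  have e : (2 * 3 ^ (j + 1 + d)) * (2 * m + 1) *
      ((Nat.stirlingFirst (2 * 3 ^ (j + 1 + d)) (2 * m + 2) : ℤ) * 3 ^ (d * (2 * m + 2))) =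
      3 ^ (j + 1 + d + v) * ((2 * u : ℕ) *
        ((Nat.stirlingFirst (2 * 3 ^ (j + 1 + d)) (2 * m + 2) : ℤ) * 3 ^ (d * (2 * m + 2)))) := by
    have : (2 * m + 1 : ℤ) = 3 ^ v * u := by exact_mod_cast hu
    rw [this]; push_cast; ring
  rw [e, pow_add, mul_dvd_mul_iff_left (by positivity)] at hmain
  refine IsCoprime.dvd_of_dvd_mul_left ?_ hmain
  have : Nat.Coprime (3 ^ (E + (j + 1))) (2 * u) := by
    refine Nat.Coprime.pow_left _ (Nat.prime_three.coprime_iff_not_dvd.2 ?_)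
    rw [Nat.prime_three.dvd_mul]
    rintro (h | h)
    · omega
    · exact hu3 h
  exact_mod_cast Nat.isCoprime_iff_coprime.2 this

/-! ### Uniform bound for all k -/

/-- Every `1 ≤ l ≤ 3 ^ n` with `1 ≤ n` lies in some `[3 ^ j, 3 ^ (j + 1)]` with `j < n`. -/
theorem exists_three_pow_le_le (n l : ℕ) (hn : 1 ≤ n) (hl : 1 ≤ l) (hl' : l ≤ 3 ^ n) :
    ∃ j d t, n = j + 1 + d ∧ l = 3 ^ j + t ∧ t ≤ 2 * 3 ^ j := by
  induction n, hn using Nat.le_induction with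
  | base => exact ⟨0, 0, l - 1, rfl, by simp; omega, by simp; omega⟩
  | succ n hn ih =>
    rcases le_total l (3 ^ n) with h | h
    · obtain ⟨j, d, t, rfl, h2, h3⟩ := ih h
      exact ⟨j, d + 1, t, by ring, h2, h3⟩
    · rw [pow_succ] at hl'
      exact ⟨n, 0, l - 3 ^ n, rfl, by omega, by omega⟩

theorem four_mul_add_four_le_three_pow (j : ℕ) (hj : 1 ≤ j) : 4 * j + 4 ≤ 3 ^ (j + 1) := by
  induction j, hj using Nat.le_induction with
  | base => norm_num
  | succ j hj ih => rw [pow_succ]; omega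

theorem not_three_pow_dvd_stirlingFirst (n k : ℕ) (hn : 2 ≤ n) (hk : 1 ≤ k)
    (hkn : k ≤ 2 * 3 ^ n) : ¬ 3 ^ (3 ^ n - n) ∣ Nat.stirlingFirst (2 * 3 ^ n) k := by
  intro hdvd
  have hdvd' : (3 : ℤ) ^ (3 ^ n - n) ∣ Nat.stirlingFirst (2 * 3 ^ n) k := by exact_mod_cast hdvd
  have hnlt : n < 3 ^ n := Nat.lt_pow_self (by norm_num)
  -- Twice ⌈k/2⌉ is the even index at or just above k; its size selects the scale j.
  obtain ⟨j, d, t, rfl, hl, ht⟩ := exists_three_pow_le_le n ((k + 1) / 2) (by omega) (by omega)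
    (by omega)
  have hE : 3 ^ (j + 1) ≤ 3 ^ (j + 1 + d) := Nat.pow_le_pow_right (by norm_num) (by omega)
  have hj3 : 3 ^ (j + 1) = 3 * 3 ^ j := by rw [pow_succ]; ring
  have hjpos : 0 < 3 ^ j := by positivity
  have hcontra := not_three_pow_dvd_stirlingFirst_mul j d t ht
  rcases Nat.even_or_odd' k with ⟨m, rfl | rfl⟩
  · have hm : 2 * m = 2 * 3 ^ j + 2 * t := by omega
    rw [← hm] at hcontra
    refine hcontra ((pow_dvd_pow 3 ?_).trans
      ((pow_add (3 : ℤ) _ _).dvd.trans (mul_dvd_mul_right hdvd' (3 ^ (d * (2 * m))))))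
    rcases Nat.eq_zero_or_pos j with rfl | hj
    · have : d * 2 ≤ d * (2 * m) := Nat.mul_le_mul_left _ (by omega)
      simp at *
      omega
    · have := four_mul_add_four_le_three_pow j hj
      have : d * 2 ≤ d * (2 * m) := Nat.mul_le_mul_left _ (by omega)
      omega
  · have hm : 2 * m + 2 = 2 * 3 ^ j + 2 * t := by omega
    rw [← hm] at hcontra
    obtain ⟨v, u, hu, hv⟩ :=
      Nat.exists_eq_pow_mul_and_not_dvd (n := 2 * m + 1) (by omega) 3 (by norm_num)
    have hvj : v ≤ j + 1 := by
      by_contra! hlt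
      have h2 : 3 ^ (j + 2) ≤ 2 * m + 1 :=
        (Nat.pow_le_pow_right (by norm_num) hlt).trans (Nat.le_of_dvd (by omega) ⟨u, hv⟩)
      have : 3 ^ (j + 2) = 9 * 3 ^ j := by rw [pow_add]; ring
      omega
    refine hcontra (three_pow_dvd_succ_of_odd j d m v _ ⟨u, hv⟩ ?_ ?_ hdvd')
    · rw [hv, pow_succ, mul_dvd_mul_iff_left (by positivity)]
      exact hu
    -- For j ≥ 1, v ≤ j+1 reduces the claim to 4j+4 ≤ 3^(j+1). For j = 0 it reads 2d+v ≤ d(2m+2): an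
    -- equality at m = 0, where v = 0, while m > 0 needs d ≥ 1, that is n ≥ 2.
    · rcases Nat.eq_zero_or_pos j with rfl | hj
      · rcases Nat.eq_zero_or_pos m with rfl | hm0
        · have hv0 : v = 0 := by
            by_contra hv0
            have : 3 ∣ 2 * 0 + 1 := (dvd_pow_self 3 hv0).trans ⟨u, hv⟩
            omega
          simp at *
          omega
        · have : d * 4 ≤ d * (2 * m + 2) := Nat.mul_le_mul_left _ (by omega)
          simp at *
          omega
      · have := four_mul_add_four_le_three_pow j hj
        have : d * 2 ≤ d * (2 * m + 2) := Nat.mul_le_mul_left _ (by omega)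
        omega

/-! ### The value at k = 1 and the conclusion -/

theorem emultiplicity_three_factorial_two_mul_three_pow (n : ℕ) :
    emultiplicity 3 (2 * 3 ^ n).factorial = ((3 ^ n - 1 : ℕ) : ℕ∞) := by
  induction n with
  | zero => simp [emultiplicity_eq_zero]
  | succ n ih =>
    rw [show 2 * 3 ^ (n + 1) = 3 * (2 * 3 ^ n) by ring,
      Nat.prime_three.emultiplicity_factorial_mul, ih, ← Nat.cast_add]
    congr 1
    have : 0 < 3 ^ n := by positivity
    rw [pow_succ]
    omega

theorem emultiplicity_three_stirlingFirst_one (n : ℕ) :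
    emultiplicity 3 (Nat.stirlingFirst (2 * 3 ^ n) 1) = ((3 ^ n - n - 1 : ℕ) : ℕ∞) := by
  have hpos : 0 < 3 ^ n := by positivity
  have hn : n < 3 ^ n := Nat.lt_pow_self (by norm_num)
  obtain ⟨L, hL⟩ : ∃ L, 2 * 3 ^ n = L + 1 := ⟨2 * 3 ^ n - 1, by omega⟩
  have h := emultiplicity_three_factorial_two_mul_three_pow n
  have h2 : emultiplicity 3 (2 * 3 ^ n) = (n : ℕ∞) := by
    refine emultiplicity_eq_coe.2 ⟨dvd_mul_left _ _, ?_⟩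
    rw [pow_succ, mul_comm 2, mul_dvd_mul_iff_left (by positivity)]
    norm_num
  -- N! = N·(N-1)! with v₃(N) = n, and s(N,1) = (N-1)!.
  rw [hL, Nat.factorial_succ, Nat.prime_three.emultiplicity_mul, ← hL, h2] at h
  rw [hL, Nat.stirlingFirst_one_right]
  refine ENat.add_right_injective_of_ne_top (ENat.natCast_ne_top n) (h.trans ?_)
  show ((3 ^ n - 1 : ℕ) : ℕ∞) = (n : ℕ∞) + ((3 ^ n - n - 1 : ℕ) : ℕ∞)
  rw [← Nat.cast_add]
  congr 1
  omega

/-- `Nat.stirlingFirst N k` is the unsigned Stirling number of the first kind `s(N, k)`, and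
`emultiplicity 3 x : ℕ∞` is the 3-adic valuation `v₃(x)`, with `v₃(0) = ∞`.
The natural subtraction `3 ^ n - n - 1` never truncates, since `n + 1 ≤ 3 ^ n`. -/
theorem theorem1p5 (n k : ℕ) (hn : 1 ≤ n) (hk : 1 ≤ k) (hkn : k ≤ 2 * 3 ^ n) :
    (2 ≤ n →
      emultiplicity 3 (Nat.stirlingFirst (2 * 3 ^ n) k) ≤
          emultiplicity 3 (Nat.stirlingFirst (2 * 3 ^ n) 1) ∧
        emultiplicity 3 (Nat.stirlingFirst (2 * 3 ^ n) 1) = ((3 ^ n - n - 1 : ℕ) : ℕ∞)) ∧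
    (n = 1 →
      emultiplicity 3 (Nat.stirlingFirst (2 * 3 ^ n) k) ≤
          emultiplicity 3 (Nat.stirlingFirst (2 * 3) 3) ∧
        emultiplicity 3 (Nat.stirlingFirst (2 * 3) 3) = 2) := by
  refine ⟨fun hn2 => ⟨?_, emultiplicity_three_stirlingFirst_one n⟩, ?_⟩
  · rw [emultiplicity_three_stirlingFirst_one n]
    refine Order.le_of_lt_add_one ?_
    have hnlt : n < 3 ^ n := Nat.lt_pow_self (by norm_num)
    have e : ((3 ^ n - n - 1 : ℕ) : ℕ∞) + 1 = ((3 ^ n - n : ℕ) : ℕ∞) := by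
      rw [← Nat.cast_add_one]
      congr 1
      omega
    rw [e, emultiplicity_lt_iff_not_dvd]
    exact not_three_pow_dvd_stirlingFirst n k hn2 hk hkn
  · rintro rfl
    have h3 : emultiplicity 3 (Nat.stirlingFirst (2 * 3) 3) = 2 :=
      emultiplicity_eq_coe.2 ⟨by decide, by decide⟩
    refine ⟨?_, h3⟩
    rw [h3]
    refine Order.le_of_lt_add_one ?_
    have : emultiplicity 3 (Nat.stirlingFirst (2 * 3 ^ 1) k) < ((3 : ℕ) : ℕ∞) := by
      rw [emultiplicity_lt_iff_not_dvd]
      have : k ≤ 6 := hkn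
      interval_cases k <;> decide
    exact this
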